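/- Let $1\le N\le\infty$, $E=\{i\in\mathbb N:1\le i<N+1\}$, and consider the birth–death process on $E$ with death rates $a_i>0$ and birth rates $b_i>0$ $(i\in E)$, with Dirichlet (absorbing) boundaries at $0$ and, if $N<\infty$, at $N+1$. Put $\mu_1=1$, $\mu_k=\dfrac{b_1\cdots b_{k-1}}{a_2\cdots a_k}$ for $2\le k<N+1$, and for functions $f$ on $E$, with $f_0:=0$, let $\mu(f^2)=\sum_{k\in E}\mu_kf_k^2$ and $$D(f)=\sum_{k\in E}\mu_ka_k(f_k-f_{k-1})^2+\mathbf 1_{\{N<\infty\}}\,\mu_Nb_Nf_N^2 ,\qquad \lambda_0=\inf\{D(f):\ \mu(f^2)=1,\ f\text{ of finite support}\}.$$ Let also $$\lambda_0^{(4.2)}=\inf\Big\{\sum_{k\in E}\mu_ka_k(f_k-f_{k-1})^2:\ \mu(f^2)=1,\ f_0=0\Big\}.$$ Define the dual rates on $\widehat E=\{i\ge 0:\ i<N+1\}$ by $\hat b_i=a_{i+1}$, $\hat a_i=b_i$, with the conventions $b_0=0$ and $a_{N+1}=0$ if $N<\infty$, and put $\hat\mu_0=1$, $\hat\mu_n=\dfrac{\hat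 b_0\cdots\hat b_{n-1}}{\hat a_1\cdots\hat a_n}$ and $\widehat D(f)=\sum_{0\le i<N}\hat\mu_i\hat b_i(f_{i+1}-f_i)^2$ for functions $f$ on $\widehat E$. All infima are over real functions and are taken in $[0,\infty]$. 1. If $\displaystyle\sum_{k=1}^N\frac1{\mu_ka_k}<\infty$, then $\sum_{i=0}^N\hat\mu_i<\infty$, and $\lambda_0=\hat\lambda_1$, where $\hat\lambda_1$ is the spectral gap of the (maximal, ergodic) dual process, $$\hat\lambda_1=\inf\Big\{\widehat D(f):\ \sum_{i\in\widehat E}\hat\mu_if_i=0,\ \sum_{i\in\widehat E}\hat\mu_if_i^2=1\Big\}.$$ 2. If $\displaystyle\sum_{k=1}^N\frac1{\mu_ka_k}=\infty$ and $\displaystyle\sum_{i\in E}\mu_i=\infty$ (so that $N=\infty$), then $\lambda_0=\lambda_0^{(4.2)}=\hat\lambda_0=0$, where $$\hat\lambda_0=\inf\Big\{\widehat D(f):\ \sum_{i\in\widehat E}\hat\mu_if_i^2=1,\ f\text{ of finite support}\Big\}.$$ -/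

import Mathlib

open scoped ENNReal

namespace BirthDeath

noncomputable section

/-- The states `1 ≤ i < N + 1` of a chain absorbed at `0` (here `1 ≤ N ≤ ∞`). -/
def statesFromOne (N : ℕ∞) : Set ℕ := {i | 1 ≤ i ∧ (i : ℕ∞) ≤ N}

/-- The states `0 ≤ i < N + 1` of a chain reflected at `0`. -/
def statesFromZero (N : ℕ∞) : Set ℕ := {i | (i : ℕ∞) ≤ N}

/-- Symmetric measure on `{1, …, N}`, with death rates `a` and birth rates `b`:
`μ 1 = 1` and `μ k = (b 1 ⋯ b (k-1)) / (a 2 ⋯ a k)`. -/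
def muOne (a b : ℕ → ℝ) (k : ℕ) : ℝ :=
  (∏ j ∈ Finset.Ico 1 k, b j) / ∏ j ∈ Finset.Icc 2 k, a j

/-- Symmetric measure on `{0, …, N}`, with death rates `a` and birth rates `b`:
`μ 0 = 1` and `μ n = (b 0 ⋯ b (n-1)) / (a 1 ⋯ a n)`. -/
def muZero (a b : ℕ → ℝ) (n : ℕ) : ℝ :=
  (∏ j ∈ Finset.range n, b j) / ∏ j ∈ Finset.Icc 1 n, a j

/-- The integral `∑_{i ∈ E} m i * g i ∈ [0, ∞]` of a nonnegative function `g`. -/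
def mass (E : Set ℕ) (m g : ℕ → ℝ) : ℝ≥0∞ :=
  ∑' i : E, ENNReal.ofReal (m i * g i)

/-! A function on the state space `E ⊆ ℕ` is a function on `ℕ` that vanishes outside `E`.
So for `E = {1, …, N}` the boundary conditions `f 0 = 0` and `f (N + 1) = 0` are built in. -/

/-- `∑_{k=1}^N μ k * a k * (f k - f (k-1))^2 ∈ [0, ∞]`: the energy on `{1, …, N}` with a Dirichlet
boundary at `0`, and reflection at the right end. -/
def energyDN (N : ℕ∞) (a b f : ℕ → ℝ) : ℝ≥0∞ :=
  ∑' k : statesFromOne N, ENNReal.ofReal (muOne a b k * a k * (f k - f (k - 1)) ^ 2)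

/-- The energy on `{1, …, N}` with Dirichlet boundaries at `0` and, if `N < ∞`, at `N + 1`. The
latter contributes `μ N * b N * (f (N+1) - f N)^2` with `f (N+1) = 0`. -/
def energyDD (N : ℕ∞) (a b f : ℕ → ℝ) : ℝ≥0∞ :=
  energyDN N a b f +
    if N = ⊤ then 0
    else ENNReal.ofReal (muOne a b N.toNat * b N.toNat * f N.toNat ^ 2)

/-- `∑_{0 ≤ i < N} μ i * b i * (f (i+1) - f i)^2 + ∑_{0 ≤ i < N + 1} μ i * c i * (f i)^2`: the
energy on `{0, …, N}` with reflection at `0` and killing rates `c`. -/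
def energyN (N : ℕ∞) (a b c f : ℕ → ℝ) : ℝ≥0∞ :=
  (∑' i : {i : ℕ | (i : ℕ∞) < N}, ENNReal.ofReal (muZero a b i * b i * (f (i + 1) - f i) ^ 2)) +
    ∑' i : statesFromZero N, ENNReal.ofReal (muZero a b i * c i * f i ^ 2)

/-- Bilateral Dirichlet eigenvalue (minimal process on `{1, …, N}`): infimum of the energy over the
finitely supported `f` with `μ(f²) = 1`. -/
def lambdaDD (N : ℕ∞) (a b : ℕ → ℝ) : ℝ≥0∞ :=
  sInf {x | ∃ f : ℕ → ℝ, f.support ⊆ statesFromOne N ∧ f.support.Finite ∧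
    mass (statesFromOne N) (muOne a b) (fun i => f i ^ 2) = 1 ∧ x = energyDD N a b f}

/-- Eigenvalue of the maximal process on `{1, …, N}` with a Dirichlet boundary at `0` and a
reflecting right end: as above, but over all `f` with `μ(f²) = 1`. -/
def lambdaDN (N : ℕ∞) (a b : ℕ → ℝ) : ℝ≥0∞ :=
  sInf {x | ∃ f : ℕ → ℝ, f.support ⊆ statesFromOne N ∧
    mass (statesFromOne N) (muOne a b) (fun i => f i ^ 2) = 1 ∧ x = energyDN N a b f}

/-- Eigenvalue of the minimal process on `{0, …, N}` reflected at `0`, with killing rates `c`. -/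
def lambdaND (N : ℕ∞) (a b c : ℕ → ℝ) : ℝ≥0∞ :=
  sInf {x | ∃ f : ℕ → ℝ, f.support ⊆ statesFromZero N ∧ f.support.Finite ∧
    mass (statesFromZero N) (muZero a b) (fun i => f i ^ 2) = 1 ∧ x = energyN N a b c f}

/-- Spectral gap of the maximal process on `{0, …, N}` reflected at both ends: infimum of the
energy over all `f` with `μ(f) = 0` and `μ(f²) = 1`. It is meant for `μ` of finite total mass;
then `μ(f²) = 1` makes the series `μ(f)` absolutely convergent. -/
def spectralGap (N : ℕ∞) (a b : ℕ → ℝ) : ℝ≥0∞ :=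
  sInf {x | ∃ f : ℕ → ℝ, f.support ⊆ statesFromZero N ∧
    HasSum (fun i : statesFromZero N => muZero a b i * f i) 0 ∧
    mass (statesFromZero N) (muZero a b) (fun i => f i ^ 2) = 1 ∧ x = energyN N a b 0 f}

/-- Dual birth rates `a (i+1)`, `0 ≤ i < N + 1`, with the convention `a (N+1) = 0`. -/
def dualBirth (N : ℕ∞) (a : ℕ → ℝ) (i : ℕ) : ℝ := if (i : ℕ∞) < N then a (i + 1) else 0

/-- Dual death rates `b i`, `0 ≤ i < N + 1`, with the convention `b 0 = 0`. -/
def dualDeath (b : ℕ → ℝ) (i : ℕ) : ℝ := if i = 0 then 0 else b i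

end

end BirthDeath

namespace BirthDeath

open Finset

/-! ### The two reversible measures and the identities that exchange them. -/

section Weights

variable {N : ℕ∞} {a b : ℕ → ℝ}

/-! Duality exchanges measures and conductances. With `p` the dual measure, `p n * μ (n+1) * a (n+1)
= a 1`, so D(f) = a₁ ∑ (f(n+1) - f(n))² / p(n), while the dual form is a₁ ∑ (g(i+1) - g(i))² /
μ(i+1). Up to the common factor a₁, the two generators are thus A*A and AA* for one weighted
difference operator A, and these have the same nonzero spectrum. Centring g removes the constants,
the kernel on the dual side.

Spectral theory is replaced by summation by parts, ∑ (f(n+1) - f(n)) g(n) = -∑ f(i+1)(g(i+1) -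
g(i)), and Cauchy–Schwarz. For gap ≤ λ₀ (`spectralGap_dual_le_lambdaDD`), a given f is paired with
the centred g whose increments are -μf: then D̂(g) = a₁ μ(f²) and a₁ μ(f²)² ≤ D(f) p(g²). For λ₀ ≤
gap (`lambdaDD_le_spectralGap_dual`), a given g is paired with the partial sums f of p(g - c), where
c is the mean of g on a finite truncation; the truncation is then removed by a limit.

When ∑ p and ∑ μ both diverge, each is at once an infinite mass for one chain and an infinite
resistance for the other. Cutoffs of bounded energy that equal 1 on arbitrarily long intervals
(`exists_cutoff`) make the Rayleigh quotients tend to 0. -/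

lemma succ_mem_statesFromOne {i : ℕ} : i + 1 ∈ statesFromOne N ↔ (i : ℕ∞) < N := by
  simp only [statesFromOne, Set.mem_ofPred_eq, Nat.cast_add, Nat.cast_one]
  rw [ENat.add_one_le_iff (ENat.natCast_ne_top i)]
  simp

lemma muOne_one : muOne a b 1 = 1 := by simp [muOne]

lemma muOne_pos (ha : ∀ i ∈ statesFromOne N, 0 < a i) (hb : ∀ i ∈ statesFromOne N, 0 < b i)
    {k : ℕ} (hk : k ∈ statesFromOne N) : 0 < muOne a b k := by
  have hle : ∀ j, 1 ≤ j → j ≤ k → j ∈ statesFromOne N := fun j h1 h2 =>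
    ⟨h1, le_trans (by exact_mod_cast h2) hk.2⟩
  refine div_pos (prod_pos fun j hj => ?_) (prod_pos fun j hj => ?_)
  · rw [mem_Ico] at hj
    exact hb j (hle j hj.1 hj.2.le)
  · rw [mem_Icc] at hj
    exact ha j (hle j (by omega) hj.2)

lemma muOne_succ_mul (n : ℕ) (h : a (n + 2) ≠ 0) :
    muOne a b (n + 2) * a (n + 2) = muOne a b (n + 1) * b (n + 1) := by
  simp only [muOne]
  rw [prod_Ico_succ_top (by omega : 1 ≤ n + 1),
    prod_Icc_succ_top (by omega : 2 ≤ n + 1 + 1), show n + 1 + 1 = n + 2 from rfl]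
  rw [div_mul_eq_mul_div, mul_div_mul_right _ _ h]
  ring

lemma muZero_zero : muZero a b 0 = 1 := by simp [muZero]

lemma muZero_succ (n : ℕ) : muZero a b (n + 1) = muZero a b n * b n / a (n + 1) := by
  simp only [muZero]
  rw [prod_range_succ, prod_Icc_succ_top (by omega : 1 ≤ n + 1)]
  rw [div_mul_eq_mul_div, div_div]

lemma dualMu_succ_mul {n : ℕ} (hn : (n : ℕ∞) < N) (h : b (n + 1) ≠ 0) :
    muZero (dualDeath b) (dualBirth N a) (n + 1) * b (n + 1) =
      muZero (dualDeath b) (dualBirth N a) n * a (n + 1) := by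
  rw [muZero_succ]
  simp [dualDeath, dualBirth, hn, h]

lemma dualMu_pos (ha : ∀ i ∈ statesFromOne N, 0 < a i) (hb : ∀ i ∈ statesFromOne N, 0 < b i)
    (n : ℕ) (hn : (n : ℕ∞) ≤ N) : 0 < muZero (dualDeath b) (dualBirth N a) n := by
  induction n with
  | zero => simp [muZero_zero]
  | succ n ih =>
    have hn' : (n : ℕ∞) < N := lt_of_lt_of_le (by exact_mod_cast Nat.lt_succ_self n) hn
    have hm := succ_mem_statesFromOne.2 hn'
    rw [muZero_succ]
    simp only [dualDeath, dualBirth, hn', if_true, Nat.succ_ne_zero, if_false]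
    exact div_pos (mul_pos (ih hn'.le) (ha _ hm)) (hb _ hm)

/-- The convention on the last dual birth rate makes the dual death rate entering the product zero,
or one already past it; in either case the recursion stops. Sums against the dual measure may
therefore run over all of ℕ. -/
lemma dualMu_eq_zero (n : ℕ) (hn : N < (n : ℕ∞)) :
    muZero (dualDeath b) (dualBirth N a) n = 0 := by
  induction n with
  | zero => simp at hn
  | succ n ih =>
    rw [muZero_succ]
    have : ¬ (n : ℕ∞) < N := fun h => by
      have := (succ_mem_statesFromOne.2 h).2
      exact absurd hn (not_lt.2 this)
    simp [dualBirth, this]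

lemma dualMu_nonneg (ha : ∀ i ∈ statesFromOne N, 0 < a i) (hb : ∀ i ∈ statesFromOne N, 0 < b i)
    (n : ℕ) : 0 ≤ muZero (dualDeath b) (dualBirth N a) n := by
  rcases le_or_gt (n : ℕ∞) N with h | h
  · exact (dualMu_pos ha hb n h).le
  · rw [dualMu_eq_zero n h]

/-- The heart of the duality. Detailed balance for the dual measure passes from the first identity
to the second at the same `n`; detailed balance for `muOne` turns the second at `n` into the first
at `n + 1`. -/
lemma dualMu_mul_muOne_birth (ha : ∀ i ∈ statesFromOne N, 0 < a i)
    (hb : ∀ i ∈ statesFromOne N, 0 < b i) (n : ℕ) (hn : (n : ℕ∞) < N) :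
    muZero (dualDeath b) (dualBirth N a) n * (muOne a b (n + 1) * a (n + 1)) = a 1 ∧
    muZero (dualDeath b) (dualBirth N a) (n + 1) * (muOne a b (n + 1) * b (n + 1)) = a 1 := by
  have key : ∀ n : ℕ, (n : ℕ∞) < N →
      muZero (dualDeath b) (dualBirth N a) n * (muOne a b (n + 1) * a (n + 1)) = a 1 →
      muZero (dualDeath b) (dualBirth N a) (n + 1) * (muOne a b (n + 1) * b (n + 1)) = a 1 := by
    intro n hn h
    have := dualMu_succ_mul (a := a) (b := b) hn (hb _ (succ_mem_statesFromOne.2 hn)).ne'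
    linear_combination h + muOne a b (n + 1) * this
  suffices h : muZero (dualDeath b) (dualBirth N a) n * (muOne a b (n + 1) * a (n + 1)) = a 1 from
    ⟨h, key n hn h⟩
  induction n with
  | zero => simp [muZero_zero, muOne_one]
  | succ n ih =>
    have hn' : (n : ℕ∞) < N := lt_trans (by exact_mod_cast Nat.lt_succ_self n) hn
    rw [muOne_succ_mul n (ha _ (succ_mem_statesFromOne.2 hn)).ne']
    exact key n hn' (ih hn')

lemma muOne_mul_death (ha : ∀ i ∈ statesFromOne N, 0 < a i)
    (hb : ∀ i ∈ statesFromOne N, 0 < b i) {n : ℕ} (hn : (n : ℕ∞) < N) :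
    muOne a b (n + 1) * a (n + 1) = a 1 / muZero (dualDeath b) (dualBirth N a) n := by
  rw [eq_div_iff (dualMu_pos ha hb n hn.le).ne', mul_comm]
  exact (dualMu_mul_muOne_birth ha hb n hn).1

lemma muOne_mul_birth (ha : ∀ i ∈ statesFromOne N, 0 < a i)
    (hb : ∀ i ∈ statesFromOne N, 0 < b i) {n : ℕ} (hn : n ∈ statesFromOne N) :
    muOne a b n * b n = a 1 / muZero (dualDeath b) (dualBirth N a) n := by
  obtain ⟨k, rfl⟩ : ∃ k, n = k + 1 := ⟨n - 1, by have := hn.1; omega⟩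
  rw [eq_div_iff (dualMu_pos ha hb _ hn.2).ne', mul_comm]
  exact (dualMu_mul_muOne_birth ha hb k (succ_mem_statesFromOne.1 hn)).2

lemma dualMu_mul_dualBirth (ha : ∀ i ∈ statesFromOne N, 0 < a i)
    (hb : ∀ i ∈ statesFromOne N, 0 < b i) {n : ℕ} (hn : (n : ℕ∞) < N) :
    muZero (dualDeath b) (dualBirth N a) n * dualBirth N a n = a 1 / muOne a b (n + 1) := by
  rw [eq_div_iff (muOne_pos ha hb (succ_mem_statesFromOne.2 hn)).ne', dualBirth, if_pos hn]
  linear_combination (dualMu_mul_muOne_birth ha hb n hn).1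

end Weights

/-! ### Rayleigh quotients, and energies and masses as plain sums. -/

section Sums

variable {N : ℕ∞} {a b : ℕ → ℝ}

lemma tsum_statesFromOne (N : ℕ∞) (F : ℕ → ℝ≥0∞) :
    ∑' k : statesFromOne N, F k = ∑' i : ℕ, if (i : ℕ∞) < N then F (i + 1) else 0 := by
  classical
  rw [_root_.tsum_subtype, tsum_eq_zero_add' ENNReal.summable]
  have h0 : (0 : ℕ) ∉ statesFromOne N := fun h => by simpa using h.1
  rw [Set.indicator_of_notMem h0, zero_add]
  refine tsum_congr fun i => ?_
  simp only [Set.indicator_apply, succ_mem_statesFromOne]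

lemma tsum_lt (N : ℕ∞) (F : ℕ → ℝ≥0∞) :
    ∑' k : {i : ℕ | (i : ℕ∞) < N}, F k = ∑' i : ℕ, if (i : ℕ∞) < N then F i else 0 := by
  classical
  rw [_root_.tsum_subtype]
  refine tsum_congr fun i => ?_
  simp only [Set.indicator_apply, Set.mem_ofPred_eq]

/-- Homogeneity: scaling by `1 / √m` normalises the mass, so a bound for normalised functions
becomes a Rayleigh inequality. Mass zero is harmless in product form. -/
lemma mul_mass_le {L m e : ℝ≥0∞} (hm : m ≠ ⊤)
    (h : ∀ c : ℝ, ENNReal.ofReal (c ^ 2) * m = 1 → L ≤ ENNReal.ofReal (c ^ 2) * e) :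
    L * m ≤ e := by
  rcases eq_or_ne m 0 with rfl | h0
  · simp
  have hp : 0 < m.toReal := ENNReal.toReal_pos h0 hm
  have hc : ENNReal.ofReal ((1 / √m.toReal) ^ 2) * m = 1 := by
    rw [div_pow, Real.sq_sqrt hp.le, one_pow, one_div, ENNReal.ofReal_inv_of_pos hp,
      ENNReal.ofReal_toReal hm, ENNReal.inv_mul_cancel h0 hm]
  calc L * m ≤ ENNReal.ofReal ((1 / √m.toReal) ^ 2) * e * m := by gcongr; exact h _ hc
    _ = (ENNReal.ofReal ((1 / √m.toReal) ^ 2) * m) * e := by ring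
    _ = e := by rw [hc, one_mul]

lemma ofReal_scale {c x y : ℝ} (h : x = c ^ 2 * y) :
    ENNReal.ofReal x = ENNReal.ofReal (c ^ 2) * ENNReal.ofReal y := by
  rw [h, ENNReal.ofReal_mul (sq_nonneg c)]

lemma mass_smul (E : Set ℕ) (m f : ℕ → ℝ) (c : ℝ) :
    mass E m (fun i => (c * f i) ^ 2) = ENNReal.ofReal (c ^ 2) * mass E m (fun i => f i ^ 2) := by
  simp only [mass]
  rw [← ENNReal.tsum_mul_left]
  exact tsum_congr fun i => ofReal_scale (by ring)

lemma energyDN_smul (N : ℕ∞) (a b f : ℕ → ℝ) (c : ℝ) :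
    energyDN N a b (fun i => c * f i) = ENNReal.ofReal (c ^ 2) * energyDN N a b f := by
  simp only [energyDN]
  rw [← ENNReal.tsum_mul_left]
  exact tsum_congr fun i => ofReal_scale (by ring)

lemma energyDD_smul (N : ℕ∞) (a b f : ℕ → ℝ) (c : ℝ) :
    energyDD N a b (fun i => c * f i) = ENNReal.ofReal (c ^ 2) * energyDD N a b f := by
  simp only [energyDD, energyDN_smul, mul_add]
  congr 1
  split_ifs
  · simp
  · exact ofReal_scale (by ring)

lemma energyN_smul (N : ℕ∞) (a b k f : ℕ → ℝ) (c : ℝ) :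
    energyN N a b k (fun i => c * f i) = ENNReal.ofReal (c ^ 2) * energyN N a b k f := by
  simp only [energyN, mul_add]
  rw [← ENNReal.tsum_mul_left, ← ENNReal.tsum_mul_left]
  congr 1
  · exact tsum_congr fun i => ofReal_scale (by ring)
  · exact tsum_congr fun i => ofReal_scale (by ring)

lemma support_smul_subset (f : ℕ → ℝ) (c : ℝ) :
    (fun i => c * f i).support ⊆ f.support := fun _ hi => right_ne_zero_of_mul hi

lemma lambdaDD_mul_mass_le {f : ℕ → ℝ} (hf : f.support ⊆ statesFromOne N)
    (hfin : f.support.Finite)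
    (hm : mass (statesFromOne N) (muOne a b) (fun i => f i ^ 2) ≠ ⊤) :
    lambdaDD N a b * mass (statesFromOne N) (muOne a b) (fun i => f i ^ 2) ≤ energyDD N a b f := by
  refine mul_mass_le hm fun c hc => sInf_le ⟨fun i => c * f i, ?_, ?_, ?_, ?_⟩
  · exact (support_smul_subset f c).trans hf
  · exact hfin.subset (support_smul_subset f c)
  · rw [mass_smul, hc]
  · rw [energyDD_smul]

lemma lambdaND_mul_mass_le {k f : ℕ → ℝ} (hf : f.support ⊆ statesFromZero N)
    (hfin : f.support.Finite)
    (hm : mass (statesFromZero N) (muZero a b) (fun i => f i ^ 2) ≠ ⊤) :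
    lambdaND N a b k * mass (statesFromZero N) (muZero a b) (fun i => f i ^ 2) ≤
      energyN N a b k f := by
  refine mul_mass_le hm fun c hc => sInf_le ⟨fun i => c * f i, ?_, ?_, ?_, ?_⟩
  · exact (support_smul_subset f c).trans hf
  · exact hfin.subset (support_smul_subset f c)
  · rw [mass_smul, hc]
  · rw [energyN_smul]

lemma spectralGap_mul_mass_le {f : ℕ → ℝ} (hf : f.support ⊆ statesFromZero N)
    (hmean : HasSum (fun i : statesFromZero N => muZero a b i * f i) 0)
    (hm : mass (statesFromZero N) (muZero a b) (fun i => f i ^ 2) ≠ ⊤) :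
    spectralGap N a b * mass (statesFromZero N) (muZero a b) (fun i => f i ^ 2) ≤
      energyN N a b 0 f := by
  refine mul_mass_le hm fun c hc => sInf_le ⟨fun i => c * f i, ?_, ?_, ?_, ?_⟩
  · exact (support_smul_subset f c).trans hf
  · simpa [mul_left_comm] using hmean.mul_left c
  · rw [mass_smul, hc]
  · rw [energyN_smul]

lemma energyN_dual (ha : ∀ i ∈ statesFromOne N, 0 < a i)
    (hb : ∀ i ∈ statesFromOne N, 0 < b i) (g : ℕ → ℝ) :
    energyN N (dualDeath b) (dualBirth N a) 0 g =
      ∑' i : ℕ, if (i : ℕ∞) < N then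
        ENNReal.ofReal (a 1 * ((g (i + 1) - g i) ^ 2 / muOne a b (i + 1))) else 0 := by
  have h0 : ∑' i : statesFromZero N, ENNReal.ofReal
      (muZero (dualDeath b) (dualBirth N a) i * (0 : ℕ → ℝ) i * g i ^ 2) = 0 := by simp
  rw [energyN, h0, add_zero]
  rw [tsum_lt N fun i => ENNReal.ofReal (muZero (dualDeath b) (dualBirth N a) i *
    dualBirth N a i * (g (i + 1) - g i) ^ 2)]
  refine tsum_congr fun i => ?_
  split_ifs with h
  · rw [dualMu_mul_dualBirth ha hb h]; congr 1; ring
  · rfl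

lemma tsum_lt_eq_sum {F : ℕ → ℝ} {M : ℕ} (hM : (M : ℕ∞) ≤ N) (hF : ∀ i < M, 0 ≤ F i)
    (hF0 : ∀ i, M ≤ i → (i : ℕ∞) < N → F i = 0) :
    (∑' i : ℕ, if (i : ℕ∞) < N then ENNReal.ofReal (F i) else 0) =
      ENNReal.ofReal (∑ i ∈ range M, F i) := by
  rw [tsum_eq_sum (s := range M), ENNReal.ofReal_sum_of_nonneg fun i hi => hF i (mem_range.1 hi)]
  · refine sum_congr rfl fun i hi => ?_
    rw [if_pos]
    exact lt_of_lt_of_le (by exact_mod_cast mem_range.1 hi) hM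
  · intro i hi
    split_ifs with h
    · rw [hF0 i (by simpa using hi) h, ENNReal.ofReal_zero]
    · rfl

lemma mass_one_eq_sum (ha : ∀ i ∈ statesFromOne N, 0 < a i)
    (hb : ∀ i ∈ statesFromOne N, 0 < b i) {f : ℕ → ℝ} {M : ℕ} (hM : (M : ℕ∞) ≤ N)
    (hf : ∀ k, M < k → f k = 0) :
    mass (statesFromOne N) (muOne a b) (fun i => f i ^ 2) =
      ENNReal.ofReal (∑ i ∈ range M, muOne a b (i + 1) * f (i + 1) ^ 2) := by
  rw [mass, tsum_statesFromOne N fun i => ENNReal.ofReal (muOne a b i * f i ^ 2),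
    tsum_lt_eq_sum (F := fun i => muOne a b (i + 1) * f (i + 1) ^ 2) hM]
  · intro i hi
    refine mul_nonneg (muOne_pos ha hb (N := N) (succ_mem_statesFromOne.2 ?_)).le (sq_nonneg _)
    exact lt_of_lt_of_le (by exact_mod_cast hi) hM
  · intro i hi _
    rw [hf (i + 1) (by omega)]; ring

/-- For finite `N` the boundary term at `N + 1` is exactly the summand `n = N`, because μ(N) b(N) =
a₁ / p(N) and f(N+1) = 0. Finite and infinite `N` then share one formula. -/
lemma energyDD_eq_sum (hN : 1 ≤ N) (ha : ∀ i ∈ statesFromOne N, 0 < a i)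
    (hb : ∀ i ∈ statesFromOne N, 0 < b i) {f : ℕ → ℝ} {M : ℕ} (hM : (M : ℕ∞) ≤ N)
    (hf : ∀ k, M < k → f k = 0) :
    energyDD N a b f = ENNReal.ofReal (a 1 * ∑ n ∈ range (M + 1),
      (f (n + 1) - f n) ^ 2 / muZero (dualDeath b) (dualBirth N a) n) := by
  set p := muZero (dualDeath b) (dualBirth N a) with hp
  have ha1 : 0 < a 1 := ha 1 ⟨le_rfl, by simpa using hN⟩
  have hpn : ∀ n : ℕ, 0 ≤ p n := dualMu_nonneg ha hb
  have hDN : energyDN N a b f = ∑' i : ℕ, if (i : ℕ∞) < N then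
      ENNReal.ofReal (a 1 * ((f (i + 1) - f i) ^ 2 / p i)) else 0 := by
    rw [energyDN, tsum_statesFromOne N fun k =>
      ENNReal.ofReal (muOne a b k * a k * (f k - f (k - 1)) ^ 2)]
    refine tsum_congr fun i => ?_
    split_ifs with h
    · rw [muOne_mul_death ha hb h, Nat.add_sub_cancel]; congr 1; ring
    · rfl
  have hnn : ∀ i, 0 ≤ a 1 * ((f (i + 1) - f i) ^ 2 / p i) := fun i =>
    mul_nonneg ha1.le (div_nonneg (sq_nonneg _) (hpn i))
  have hz : ∀ i, M + 1 ≤ i → a 1 * ((f (i + 1) - f i) ^ 2 / p i) = 0 := fun i hi => by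
    rw [hf i (by omega), hf (i + 1) (by omega)]; simp
  rw [energyDD, hDN, mul_sum]
  induction N using ENat.recTopCoe with
  | top =>
    rw [if_pos rfl, add_zero]
    exact tsum_lt_eq_sum le_top (fun i _ => hnn i) fun i hi _ => hz i hi
  | coe K =>
    have hMK : M ≤ K := by exact_mod_cast hM
    rw [if_neg (ENat.natCast_ne_top K), ENat.toNat_natCast,
      tsum_lt_eq_sum (M := K) le_rfl (fun i _ => hnn i) (fun _ hi h => absurd h (by
        simpa using hi)), muOne_mul_birth ha hb (n := K) ⟨by exact_mod_cast hN, le_rfl⟩,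
      ← ENNReal.ofReal_add (sum_nonneg fun i _ => hnn i)
        (mul_nonneg (div_nonneg ha1.le (hpn K)) (sq_nonneg _))]
    congr 1
    rw [sum_subset (range_subset_range.2 (Nat.succ_le_succ hMK))
      fun _ _ hi => hz _ (by simpa using hi), sum_range_succ, hf (K + 1) (by omega)]
    ring

end Sums

end BirthDeath
namespace BirthDeath

open Finset Filter Topology

/-! ### Equality of the Dirichlet eigenvalue and the dual spectral gap. -/

section Duality

variable {N : ℕ∞} {a b : ℕ → ℝ}

lemma sum_sub_mul_by_parts (f g : ℕ → ℝ) (M : ℕ) :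
    ∑ n ∈ range (M + 1), (f (n + 1) - f n) * g n =
      f (M + 1) * g M - f 0 * g 0 - ∑ i ∈ range M, f (i + 1) * (g (i + 1) - g i) := by
  induction M with
  | zero => simp; ring
  | succ M ih => rw [sum_range_succ, ih, sum_range_succ _ M]; ring

lemma sq_sum_mul_le (s : Finset ℕ) (x y w : ℕ → ℝ) (hw : ∀ i ∈ s, 0 < w i) :
    (∑ i ∈ s, x i * y i) ^ 2 ≤ (∑ i ∈ s, x i ^ 2 / w i) * ∑ i ∈ s, w i * y i ^ 2 := by
  refine sum_sq_le_sum_mul_sum_of_sq_le_mul s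
    (fun i hi => div_nonneg (sq_nonneg _) (hw i hi).le)
    (fun i hi => mul_nonneg (hw i hi).le (sq_nonneg _)) fun i hi => ?_
  have := (hw i hi).ne'
  exact le_of_eq (by field_simp)

/-- Transfers a Rayleigh inequality to the other side of the duality: L A² ≤ L D G ≤ D t A, then
cancel A. Used in both directions, with t = a₁. -/
lemma mul_ofReal_le_of_sq_le {L : ℝ≥0∞} {t A D G : ℝ} (ht : 0 ≤ t) (hA : 0 ≤ A) (hD : 0 ≤ D)
    (h : L * ENNReal.ofReal G ≤ ENNReal.ofReal (t * A)) (hs : A ^ 2 ≤ D * G) :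
    L * ENNReal.ofReal A ≤ ENNReal.ofReal (t * D) := by
  rcases hA.eq_or_lt with rfl | hA'
  · simp
  have h1 : (L * ENNReal.ofReal A) * ENNReal.ofReal A ≤
      ENNReal.ofReal (t * D) * ENNReal.ofReal A := by
    calc (L * ENNReal.ofReal A) * ENNReal.ofReal A = L * ENNReal.ofReal (A ^ 2) := by
          rw [sq, ENNReal.ofReal_mul hA]; ring
      _ ≤ L * ENNReal.ofReal (D * G) := by gcongr
      _ = ENNReal.ofReal D * (L * ENNReal.ofReal G) := by rw [ENNReal.ofReal_mul hD]; ring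
      _ ≤ ENNReal.ofReal D * ENNReal.ofReal (t * A) := by gcongr
      _ = ENNReal.ofReal (t * D) * ENNReal.ofReal A := by
          rw [ENNReal.ofReal_mul ht, ENNReal.ofReal_mul ht]; ring
  rwa [ENNReal.mul_le_mul_iff_left (by simpa using hA') ENNReal.ofReal_ne_top] at h1

lemma exists_bound_of_finite_support {f : ℕ → ℝ} (hf : f.support ⊆ statesFromOne N)
    (hfin : f.support.Finite) : ∃ M : ℕ, (M : ℕ∞) ≤ N ∧ ∀ k, M < k → f k = 0 := by
  rcases f.support.eq_empty_or_nonempty with h | h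
  · exact ⟨0, by simp, fun k _ => by rw [Function.support_eq_empty_iff.1 h]; rfl⟩
  · obtain ⟨M, hM, hmax⟩ := hfin.exists_maximal h
    refine ⟨M, (hf hM).2, fun k hk => ?_⟩
    by_contra hne
    exact absurd (hmax (show k ∈ f.support from hne) hk.le) (not_le.2 hk)

lemma summable_dualMu (hN : 1 ≤ N) (ha : ∀ i ∈ statesFromOne N, 0 < a i)
    (hb : ∀ i ∈ statesFromOne N, 0 < b i)
    (h : ∑' k : statesFromOne N, ENNReal.ofReal (1 / (muOne a b k * a k)) < ⊤) :
    Summable (muZero (dualDeath b) (dualBirth N a)) := by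
  have ha1 : 0 < a 1 := ha 1 ⟨le_rfl, by simpa using hN⟩
  induction N using ENat.recTopCoe with
  | coe K =>
    -- For finite `N` the hypothesis carries no information, and it would miss the state `N` of the
    -- dual chain; finite support suffices.
    refine summable_of_ne_finset_zero (s := range (K + 1)) fun n hn => dualMu_eq_zero n ?_
    have : K < n := by simpa using hn
    exact_mod_cast this
  | top =>
    rw [tsum_statesFromOne ⊤ fun k => ENNReal.ofReal (1 / (muOne a b k * a k))] at h
    have h2 := (ENNReal.summable_toReal h.ne).mul_left (a 1)
    refine h2.congr fun i => ?_
    rw [if_pos (ENat.natCast_lt_top i), muOne_mul_death ha hb (ENat.natCast_lt_top i), one_div_div,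
      ENNReal.toReal_ofReal (div_nonneg (dualMu_nonneg ha hb i) ha1.le)]
    field_simp

lemma support_dualMu_mul_subset (g : ℕ → ℝ) :
    (fun n => muZero (dualDeath b) (dualBirth N a) n * g n).support ⊆ statesFromZero N := by
  intro n hn
  by_contra h
  exact hn (by simp [dualMu_eq_zero (a := a) (b := b) n (not_le.1 h)])

lemma mass_dual_eq_tsum (g : ℕ → ℝ) :
    mass (statesFromZero N) (muZero (dualDeath b) (dualBirth N a)) g =
      ∑' n : ℕ, ENNReal.ofReal (muZero (dualDeath b) (dualBirth N a) n * g n) := by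
  rw [mass]
  refine tsum_subtype_eq_of_support_subset (f := fun n : ℕ =>
    ENNReal.ofReal (muZero (dualDeath b) (dualBirth N a) n * g n)) fun n hn => ?_
  refine support_dualMu_mul_subset (a := a) (b := b) g fun h => hn ?_
  simp only at h ⊢
  rw [h, ENNReal.ofReal_zero]

lemma dualMu_pos_of_mem_range (ha : ∀ i ∈ statesFromOne N, 0 < a i)
    (hb : ∀ i ∈ statesFromOne N, 0 < b i) {M : ℕ} (hM : (M : ℕ∞) ≤ N) :
    ∀ n ∈ range (M + 1), 0 < muZero (dualDeath b) (dualBirth N a) n := fun n hn =>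
  dualMu_pos ha hb n (le_trans (by
    have : n ≤ M := by simpa [Nat.lt_succ_iff] using hn
    exact_mod_cast this) hM)

lemma muOne_succ_pos (ha : ∀ i ∈ statesFromOne N, 0 < a i)
    (hb : ∀ i ∈ statesFromOne N, 0 < b i) {M : ℕ} (hM : (M : ℕ∞) ≤ N) :
    ∀ n ∈ range M, 0 < muOne a b (n + 1) := fun n hn =>
  muOne_pos ha hb (succ_mem_statesFromOne.2 (lt_of_lt_of_le (by
    exact_mod_cast mem_range.1 hn) hM))

/-- A primitive of `u` frozen at `M` is bounded, hence integrable and square integrable for the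
finite dual measure, so its mean can be subtracted. Setting it to zero outside the state space costs
nothing, as the measure vanishes there. -/
lemma exists_centered_potential (hp : Summable (muZero (dualDeath b) (dualBirth N a)))
    (ha : ∀ i ∈ statesFromOne N, 0 < a i) (hb : ∀ i ∈ statesFromOne N, 0 < b i)
    (u : ℕ → ℝ) (M : ℕ) :
    ∃ g : ℕ → ℝ, g.support ⊆ statesFromZero N ∧
      HasSum (fun n => muZero (dualDeath b) (dualBirth N a) n * g n) 0 ∧
      Summable (fun n => muZero (dualDeath b) (dualBirth N a) n * g n ^ 2) ∧
      (∀ i < M, (i : ℕ∞) < N → g (i + 1) - g i = u i) ∧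
      ∀ i, M ≤ i → (i : ℕ∞) < N → g (i + 1) - g i = 0 := by
  classical
  set p := muZero (dualDeath b) (dualBirth N a) with hpdef
  have hpn : ∀ n, 0 ≤ p n := dualMu_nonneg ha hb
  set h : ℕ → ℝ := fun k => ∑ i ∈ range (min k M), u i with hh
  set B := ∑ i ∈ range M, |u i| with hB
  have hbd : ∀ k, |h k| ≤ B := fun k => (abs_sum_le_sum_abs _ _).trans
    (sum_le_sum_of_subset_of_nonneg (range_subset_range.2 (min_le_right _ _))
      fun _ _ _ => abs_nonneg _)
  have hph : Summable fun n => p n * h n := by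
    refine Summable.of_norm_bounded (hp.mul_right B) fun n => ?_
    rw [Real.norm_eq_abs, abs_mul, abs_of_nonneg (hpn n)]
    exact mul_le_mul_of_nonneg_left (hbd n) (hpn n)
  have hP : 0 < ∑' n, p n := hp.tsum_pos hpn 0 (by simp [hpdef, muZero_zero])
  set c := (∑' n, p n * h n) / ∑' n, p n with hc
  have hoff : ∀ n : ℕ, ¬ (n : ℕ∞) ≤ N → p n = 0 := fun n hn =>
    dualMu_eq_zero n (not_le.1 hn)
  have hin : ∀ n : ℕ, (n : ℕ∞) < N → ((n + 1 : ℕ) : ℕ∞) ≤ N := fun n hn =>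
    (succ_mem_statesFromOne.2 hn).2
  refine ⟨fun n => if (n : ℕ∞) ≤ N then h n - c else 0, ?_, ?_, ?_, ?_, ?_⟩
  · intro n hn
    by_contra hne
    exact hn (if_neg hne)
  · have h1 : HasSum (fun n => p n * h n - p n * c) 0 := by
      have := hph.hasSum.sub (hp.hasSum.mul_right c)
      rwa [hc, mul_div_cancel₀ _ hP.ne', sub_self] at this
    refine h1.congr_fun fun n => ?_
    beta_reduce
    split_ifs with hn
    · ring
    · simp [hoff n hn]
  · refine Summable.of_nonneg_of_le (fun n => mul_nonneg (hpn n) (sq_nonneg _)) (fun n => ?_)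
      (hp.mul_right ((B + |c|) ^ 2))
    refine mul_le_mul_of_nonneg_left ?_ (hpn n)
    beta_reduce
    split_ifs with hn
    · rw [← sq_abs]
      refine pow_le_pow_left₀ (abs_nonneg _) ?_ 2
      exact (abs_sub _ _).trans (by gcongr; exact hbd n)
    · rw [sq, zero_mul]; positivity
  · intro i hi hiN
    simp only [hin i hiN, hiN.le, if_true, hh]
    rw [min_eq_left hi.le, min_eq_left (Nat.succ_le_of_lt hi), sum_range_succ]
    ring
  · intro i hi hiN
    simp only [hin i hiN, hiN.le, if_true, hh]
    rw [min_eq_right hi, min_eq_right (by omega)]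
    ring

theorem spectralGap_dual_le_lambdaDD (hN : 1 ≤ N) (ha : ∀ i ∈ statesFromOne N, 0 < a i)
    (hb : ∀ i ∈ statesFromOne N, 0 < b i)
    (hp : Summable (muZero (dualDeath b) (dualBirth N a))) :
    spectralGap N (dualDeath b) (dualBirth N a) ≤ lambdaDD N a b := by
  have ha1 : 0 < a 1 := ha 1 ⟨le_rfl, by simpa using hN⟩
  refine le_sInf ?_
  rintro x ⟨f, hf, hfin, hmass, rfl⟩
  obtain ⟨M, hM, hfM⟩ := exists_bound_of_finite_support hf hfin
  have hf0 : f 0 = 0 := by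
    by_contra h
    simpa using (hf h).1
  have hppos := dualMu_pos_of_mem_range ha hb hM
  have hmpos := muOne_succ_pos ha hb hM
  -- With these increments both the dual energy of `g` (divided by a₁) and the summation by parts
  -- pairing equal μ(f²).
  obtain ⟨g, hg, hg0, hg2, hgM, hgz⟩ := exists_centered_potential hp ha hb
    (fun i => - (muOne a b (i + 1) * f (i + 1))) M
  have hpn : ∀ n, 0 ≤ muZero (dualDeath b) (dualBirth N a) n := dualMu_nonneg ha hb
  rw [energyDD_eq_sum hN ha hb hM hfM]
  rw [mass_one_eq_sum ha hb hM hfM] at hmass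
  set p := muZero (dualDeath b) (dualBirth N a) with hpdef
  set F := ∑ i ∈ range M, muOne a b (i + 1) * f (i + 1) ^ 2 with hF
  have hgM' : ∀ i ∈ range M, g (i + 1) - g i = - (muOne a b (i + 1) * f (i + 1)) := fun i hi =>
    hgM i (mem_range.1 hi) (lt_of_lt_of_le (by exact_mod_cast mem_range.1 hi) hM)
  have hEg : energyN N (dualDeath b) (dualBirth N a) 0 g = ENNReal.ofReal (a 1 * F) := by
    rw [energyN_dual ha hb, tsum_lt_eq_sum
      (F := fun i => a 1 * ((g (i + 1) - g i) ^ 2 / muOne a b (i + 1))) hM, ← mul_sum]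
    · congr 2
      refine sum_congr rfl fun i hi => ?_
      have := (hmpos i hi).ne'
      rw [hgM' i hi]
      field_simp
    · exact fun i hi => mul_nonneg ha1.le
        (div_nonneg (sq_nonneg _) (hmpos i (mem_range.2 hi)).le)
    · intro i hi hiN
      rw [hgz i hi hiN]; simp
  have hmg : mass (statesFromZero N) p (fun i => g i ^ 2) =
      ENNReal.ofReal (∑' n, p n * g n ^ 2) := by
    rw [hpdef, mass_dual_eq_tsum, ENNReal.ofReal_tsum_of_nonneg
      (fun n => mul_nonneg (hpn n) (sq_nonneg _)) hg2]
  have hmean : HasSum (fun i : statesFromZero N => p i * g i) 0 :=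
    (hasSum_subtype_iff_of_support_subset (f := fun n => p n * g n)
      (support_dualMu_mul_subset g)).2 hg0
  have hgap := spectralGap_mul_mass_le hg hmean (by rw [hmg]; exact ENNReal.ofReal_ne_top)
  rw [hmg, hEg] at hgap
  have hparts : ∑ n ∈ range (M + 1), (f (n + 1) - f n) * g n = F := by
    rw [sum_sub_mul_by_parts, hf0, hfM (M + 1) (Nat.lt_succ_self M), hF]
    rw [zero_mul, zero_mul, sub_zero, zero_sub, ← sum_neg_distrib]
    refine sum_congr rfl fun i hi => ?_
    rw [hgM' i hi]; ring
  have hcs : F ^ 2 ≤ (∑ n ∈ range (M + 1), (f (n + 1) - f n) ^ 2 / p n) * ∑' n, p n * g n ^ 2 := by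
    rw [← hparts]
    refine (sq_sum_mul_le _ _ _ p hppos).trans (mul_le_mul_of_nonneg_left ?_
      (sum_nonneg fun i hi => div_nonneg (sq_nonneg _) (hpn i)))
    exact hg2.sum_le_tsum _ fun i _ => mul_nonneg (hpn i) (sq_nonneg _)
  have := mul_ofReal_le_of_sq_le ha1.le
    (sum_nonneg fun i hi => mul_nonneg (hmpos i hi).le (sq_nonneg _))
    (sum_nonneg fun i _ => div_nonneg (sq_nonneg _) (hpn i)) hgap hcs
  rwa [hmass, mul_one] at this

/-- A truncated spectral gap inequality. Neither finite total dual mass nor a centred `g` is needed,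
and the unnormalised square of the mean is precise enough because it will tend to 0. -/
lemma lambdaDD_mul_variance_le (hN : 1 ≤ N) (ha : ∀ i ∈ statesFromOne N, 0 < a i)
    (hb : ∀ i ∈ statesFromOne N, 0 < b i) (g : ℕ → ℝ) {M : ℕ} (hM : (M : ℕ∞) ≤ N) :
    lambdaDD N a b * ENNReal.ofReal
      (∑ n ∈ range (M + 1), muZero (dualDeath b) (dualBirth N a) n * g n ^ 2 -
        (∑ n ∈ range (M + 1), muZero (dualDeath b) (dualBirth N a) n * g n) ^ 2) ≤
      energyN N (dualDeath b) (dualBirth N a) 0 g := by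
  have ha1 : 0 < a 1 := ha 1 ⟨le_rfl, by simpa using hN⟩
  have hppos := dualMu_pos_of_mem_range ha hb hM
  have hmpos := muOne_succ_pos ha hb hM
  set p := muZero (dualDeath b) (dualBirth N a) with hpdef
  set S := ∑ n ∈ range (M + 1), p n * g n with hS
  set P := ∑ n ∈ range (M + 1), p n with hP
  have hP1 : 1 ≤ P := by
    have : p 0 ≤ P := single_le_sum (fun i hi => (hppos i hi).le) (mem_range.2 (Nat.succ_pos M))
    simpa [hpdef, muZero_zero] using this
  set c := S / P with hc
  have hcP : c * P = S := div_mul_cancel₀ _ (by positivity)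
  -- By the choice of `c` the partial sum at `M + 1` is already 0, so the cutoff does not spoil the
  -- increment at `n = M`.
  set f : ℕ → ℝ := fun k => if k ≤ M then ∑ j ∈ range k, p j * (g j - c) else 0 with hf
  have hf0 : f 0 = 0 := by simp [hf]
  have hfM : ∀ k, M < k → f k = 0 := fun k hk => if_neg (not_le.2 hk)
  have hsum0 : ∑ j ∈ range (M + 1), p j * (g j - c) = 0 := by
    simp only [mul_sub, sum_sub_distrib]
    rw [← sum_mul, ← hS, ← hP, mul_comm, hcP, sub_self]
  have hdiff : ∀ n ∈ range (M + 1), f (n + 1) - f n = p n * (g n - c) := by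
    intro n hn
    have hn' : n ≤ M := by simpa [Nat.lt_succ_iff] using hn
    rcases hn'.eq_or_lt with rfl | hlt
    · rw [hfM (n + 1) (Nat.lt_succ_self n)]
      simp only [hf, le_refl, if_true]
      rw [sum_range_succ] at hsum0
      linarith
    · simp only [hf, hn', Nat.succ_le_of_lt hlt, if_true]
      rw [sum_range_succ]; ring
  set V := ∑ n ∈ range (M + 1), p n * (g n - c) ^ 2 with hV
  have hVnn : 0 ≤ V := sum_nonneg fun i hi => mul_nonneg (hppos i hi).le (sq_nonneg _)
  have hfsupp : f.support ⊆ statesFromOne N := by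
    intro k hk
    have hkM : k ≤ M := by
      by_contra h
      exact hk (hfM k (not_le.1 h))
    refine ⟨Nat.one_le_iff_ne_zero.2 fun h => hk (h ▸ hf0), le_trans ?_ hM⟩
    exact_mod_cast hkM
  have hffin : f.support.Finite := (Set.finite_Iic M).subset fun k hk => by
    by_contra h
    exact hk (hfM k (not_le.1 h))
  have hle := lambdaDD_mul_mass_le (a := a) (b := b) hfsupp hffin
    (by rw [mass_one_eq_sum ha hb hM hfM]; exact ENNReal.ofReal_ne_top)
  rw [mass_one_eq_sum ha hb hM hfM, energyDD_eq_sum hN ha hb hM hfM] at hle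
  have hDV : ∑ n ∈ range (M + 1), (f (n + 1) - f n) ^ 2 / p n = V := by
    refine sum_congr rfl fun n hn => ?_
    have := (hppos n hn).ne'
    rw [hdiff n hn]
    field_simp
  rw [← hpdef, hDV] at hle
  have hVg : ∑ n ∈ range (M + 1), (f (n + 1) - f n) * g n = V := by
    have : V = ∑ n ∈ range (M + 1), p n * (g n - c) * g n -
        c * ∑ n ∈ range (M + 1), p n * (g n - c) := by
      rw [hV, mul_sum, ← sum_sub_distrib]
      exact sum_congr rfl fun n _ => by ring
    rw [this, hsum0, mul_zero, sub_zero]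
    exact sum_congr rfl fun n hn => by rw [hdiff n hn]
  have hcs : V ^ 2 ≤ (∑ i ∈ range M, (g (i + 1) - g i) ^ 2 / muOne a b (i + 1)) *
      ∑ i ∈ range M, muOne a b (i + 1) * f (i + 1) ^ 2 := by
    have h := sq_sum_mul_le (range M) (fun i => g (i + 1) - g i) (fun i => f (i + 1)) _ hmpos
    have h2 : V = - ∑ i ∈ range M, (g (i + 1) - g i) * f (i + 1) := by
      rw [← hVg, sum_sub_mul_by_parts, hf0, hfM (M + 1) (Nat.lt_succ_self M)]
      rw [zero_mul, zero_mul, sub_zero, zero_sub]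
      simp only [mul_comm]
    rwa [h2, neg_sq]
  have hmain := mul_ofReal_le_of_sq_le ha1.le hVnn
    (sum_nonneg fun i hi => div_nonneg (sq_nonneg _) (hmpos i hi).le) hle hcs
  have hVS : ∑ n ∈ range (M + 1), p n * g n ^ 2 - S ^ 2 ≤ V := by
    have hVeq : V = ∑ n ∈ range (M + 1), p n * g n ^ 2 - c * S := by
      rw [← hVg, hS, mul_sum, ← sum_sub_distrib]
      exact sum_congr rfl fun n hn => by rw [hdiff n hn]; ring
    -- The exact correction is S² / P, and P ≥ 1 because the dual measure has mass 1 at 0.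
    have : c * S ≤ S ^ 2 := by
      rw [hc, div_mul_eq_mul_div, ← sq]
      exact div_le_self (sq_nonneg _) hP1
    linarith
  calc _ ≤ lambdaDD N a b * ENNReal.ofReal V := by gcongr
    _ ≤ _ := hmain
    _ ≤ _ := by
      rw [energyN_dual ha hb, mul_sum, ENNReal.ofReal_sum_of_nonneg fun i hi =>
        mul_nonneg ha1.le (div_nonneg (sq_nonneg _) (hmpos i hi).le)]
      refine le_trans (sum_le_sum fun i hi => ?_) (ENNReal.sum_le_tsum (range M))
      rw [if_pos (lt_of_lt_of_le (by exact_mod_cast mem_range.1 hi) hM)]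

lemma exists_nat_truncation (N : ℕ∞) (M : ℕ) :
    ∃ K : ℕ, (K : ℕ∞) ≤ N ∧ K ≤ M ∧ ∀ n : ℕ, n ≤ M → (n : ℕ∞) ≤ N → n ≤ K := by
  induction N using ENat.recTopCoe with
  | top => exact ⟨M, le_top, le_rfl, fun n h _ => h⟩
  | coe L =>
    exact ⟨min L M, by exact_mod_cast min_le_left L M, min_le_right L M, fun n h1 h2 =>
      le_min (by exact_mod_cast h2) h1⟩

theorem lambdaDD_le_spectralGap_dual (hN : 1 ≤ N) (ha : ∀ i ∈ statesFromOne N, 0 < a i)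
    (hb : ∀ i ∈ statesFromOne N, 0 < b i) :
    lambdaDD N a b ≤ spectralGap N (dualDeath b) (dualBirth N a) := by
  refine le_sInf ?_
  rintro x ⟨g, hg, hmean, hmass, rfl⟩
  have hpn : ∀ n, 0 ≤ muZero (dualDeath b) (dualBirth N a) n := dualMu_nonneg ha hb
  have key := fun M : ℕ => lambdaDD_mul_variance_le hN ha hb g (M := M)
  rw [mass_dual_eq_tsum] at hmass
  set p := muZero (dualDeath b) (dualBirth N a) with hpdef
  have h0 : HasSum (fun n => p n * g n) 0 :=
    (hasSum_subtype_iff_of_support_subset (f := fun n => p n * g n)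
      (support_dualMu_mul_subset g)).1 hmean
  have h1 : HasSum (fun n => p n * g n ^ 2) 1 := by
    have := ENNReal.hasSum_toReal (f := fun n => ENNReal.ofReal (p n * g n ^ 2))
      (by rw [hmass]; exact ENNReal.one_ne_top)
    rw [← ENNReal.tsum_toReal_eq (fun _ => ENNReal.ofReal_ne_top), hmass,
      ENNReal.toReal_one] at this
    refine this.congr_fun fun n => ?_
    rw [ENNReal.toReal_ofReal (mul_nonneg (hpn n) (sq_nonneg _))]
  have hle : ∀ M : ℕ, lambdaDD N a b * ENNReal.ofReal
      (∑ n ∈ range (M + 1), p n * g n ^ 2 - (∑ n ∈ range (M + 1), p n * g n) ^ 2) ≤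
      energyN N (dualDeath b) (dualBirth N a) 0 g := by
    intro M
    -- The previous bound needs a truncation level inside the state space; `g` vanishes beyond it,
    -- so the sums up to `M` are unchanged.
    obtain ⟨K, hKN, hKM, hK⟩ := exists_nat_truncation N M
    have hsub : range (K + 1) ⊆ range (M + 1) := range_subset_range.2 (by omega)
    have hz : ∀ n ∈ range (M + 1), n ∉ range (K + 1) → g n = 0 := by
      intro n hn hnK
      by_contra hne
      have := hK n (by simpa [Nat.lt_succ_iff] using hn) (hg hne)
      simp at hnK
      omega
    rw [← sum_subset hsub fun n hn hnK => by rw [hz n hn hnK]; ring,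
      ← sum_subset hsub fun n hn hnK => by rw [hz n hn hnK]; ring]
    exact key K hKN
  have ht : Tendsto (fun M : ℕ => lambdaDD N a b * ENNReal.ofReal
      (∑ n ∈ range (M + 1), p n * g n ^ 2 - (∑ n ∈ range (M + 1), p n * g n) ^ 2)) atTop
      (𝓝 (lambdaDD N a b * ENNReal.ofReal (1 - 0 ^ 2))) := by
    -- The limit of the second factor is 1, hence nonzero, so the eigenvalue need not be known to be
    -- finite.
    refine ENNReal.Tendsto.const_mul (ENNReal.tendsto_ofReal ?_) (Or.inl (by simp))
    exact ((tendsto_add_atTop_iff_nat 1).2 h1.tendsto_sum_nat).sub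
      (((tendsto_add_atTop_iff_nat 1).2 h0.tendsto_sum_nat).pow 2)
  have := le_of_tendsto' ht hle
  simpa using this

end Duality

end BirthDeath
namespace BirthDeath

open Finset

/-! ### Cutoff functions and the vanishing of the eigenvalues. -/

section Vanishing

variable {a b : ℕ → ℝ}

/-- The `c i` are edge resistances. Descending from 1 to 0 between `n` and `q` with increments
-c(i)/S, where S ≥ 1 is the resistance in between, costs energy 1/S. -/
lemma exists_cutoff {c : ℕ → ℝ} (hc : ∀ i, 0 < c i) (hns : ¬ Summable c) (n : ℕ) :
    ∃ (g : ℕ → ℝ) (q : ℕ), n ≤ q ∧ (∀ k ≤ n, g k = 1) ∧ (∀ k, q ≤ k → g k = 0) ∧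
      ∑ i ∈ range q, (g (i + 1) - g i) ^ 2 / c i ≤ 1 := by
  have hex : ∃ q, n ≤ q ∧ 1 ≤ ∑ i ∈ Ico n q, c i := by
    have ht := (not_summable_iff_tendsto_nat_atTop_of_nonneg fun i => (hc i).le).1 hns
    obtain ⟨q, hq, hnq⟩ := ((ht.eventually_ge_atTop (1 + ∑ i ∈ range n, c i)).and
      (Filter.eventually_ge_atTop n)).exists
    refine ⟨q, hnq, ?_⟩
    rw [sum_Ico_eq_sub _ hnq]
    linarith
  obtain ⟨q, hnq, hS⟩ := hex
  set S := ∑ i ∈ Ico n q, c i with hSdef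
  have hS0 : 0 < S := by linarith
  refine ⟨fun k => 1 - (∑ i ∈ Ico n (min k q), c i) / S, q, hnq, ?_, ?_, ?_⟩
  · intro k hk
    simp [Ico_eq_empty_of_le ((min_le_left k q).trans hk)]
  · intro k hk
    simp only [min_eq_right hk]
    rw [← hSdef, div_self hS0.ne', sub_self]
  · have hterm : ∀ i ∈ range q, ((1 - (∑ j ∈ Ico n (min (i + 1) q), c j) / S) -
        (1 - (∑ j ∈ Ico n (min i q), c j) / S)) ^ 2 / c i =
        if n ≤ i then c i / S ^ 2 else 0 := by
      intro i hi
      have hiq := mem_range.1 hi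
      rw [min_eq_left hiq.le, min_eq_left (Nat.succ_le_of_lt hiq)]
      have := (hc i).ne'
      split_ifs with h
      · rw [sum_Ico_succ_top h]
        field_simp
        ring
      · rw [Ico_eq_empty_of_le (by omega : i + 1 ≤ n), Ico_eq_empty_of_le (by omega : i ≤ n)]
        simp
    rw [sum_congr rfl hterm, ← sum_filter]
    have hfil : (range q).filter (fun i => n ≤ i) = Ico n q := by
      ext i; simp [and_comm]
    rw [hfil, ← sum_div, ← hSdef, sq, div_mul_eq_div_div, div_self hS0.ne']
    exact (div_le_one hS0).2 hS

lemma eq_zero_of_mul_sum_le {w : ℕ → ℝ} (hw : ∀ i, 0 ≤ w i) (hns : ¬ Summable w) {L C : ℝ≥0∞}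
    (hC : C ≠ ⊤) (h : ∀ n, L * ∑ i ∈ range n, ENNReal.ofReal (w i) ≤ C) : L = 0 := by
  have htop : ∑' i, ENNReal.ofReal (w i) = ⊤ := by
    by_contra hne
    refine hns ((ENNReal.summable_toReal hne).congr fun i => ?_)
    rw [ENNReal.toReal_ofReal (hw i)]
  have hle : L * ∑' i, ENNReal.ofReal (w i) ≤ C := by
    rw [ENNReal.tsum_eq_iSup_nat, ENNReal.mul_iSup]
    exact iSup_le h
  by_contra hL
  rw [htop, ENNReal.mul_top hL] at hle
  exact hC (top_le_iff.1 hle)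

lemma eq_top_of_tsum_statesFromOne_eq_top {N : ℕ∞} {F : ℕ → ℝ}
    (h : ∑' k : statesFromOne N, ENNReal.ofReal (F k) = ⊤) : N = ⊤ := by
  by_contra hN
  lift N to ℕ using hN
  have hfin : Finite (statesFromOne (N : ℕ∞)) :=
    ((Set.finite_Iic N).subset fun k hk => by exact_mod_cast hk.2).to_subtype
  have := Fintype.ofFinite (statesFromOne (N : ℕ∞))
  rw [tsum_fintype] at h
  exact ENNReal.sum_ne_top.2 (fun _ _ => ENNReal.ofReal_ne_top) h

lemma not_summable_of_tsum_statesFromOne_top {F : ℕ → ℝ}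
    (h : ∑' k : statesFromOne ⊤, ENNReal.ofReal (F k) = ⊤) : ¬ Summable fun i => F (i + 1) := by
  intro hs
  rw [tsum_statesFromOne ⊤ fun k => ENNReal.ofReal (F k)] at h
  simp only [ENat.natCast_lt_top, if_true] at h
  exact hs.tsum_ofReal_ne_top h

lemma sum_le_mass {E : Set ℕ} {m f : ℕ → ℝ} (s : Finset ℕ) (hs : ∀ i ∈ s, i ∈ E)
    (hf : ∀ i ∈ s, f i = 1) :
    ∑ i ∈ s, ENNReal.ofReal (m i) ≤ mass E m (fun i => f i ^ 2) := by
  rw [mass, _root_.tsum_subtype E fun i => ENNReal.ofReal (m i * f i ^ 2)]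
  refine le_trans (sum_le_sum fun i hi => ?_) (ENNReal.sum_le_tsum s)
  rw [Set.indicator_of_mem (hs i hi), hf i hi, one_pow, mul_one]

/-- The dual resistances are μ(i+1)/a₁, so the cutoffs built on μ have energy at most a₁, while
their dual mass is unbounded. -/
theorem lambdaND_dual_eq_zero (ha : ∀ i ∈ statesFromOne ⊤, 0 < a i)
    (hb : ∀ i ∈ statesFromOne ⊤, 0 < b i)
    (hp : ¬ Summable (muZero (dualDeath b) (dualBirth ⊤ a)))
    (hm : ¬ Summable fun i => muOne a b (i + 1)) :
    lambdaND ⊤ (dualDeath b) (dualBirth ⊤ a) 0 = 0 := by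
  have ha1 : 0 < a 1 := ha 1 ⟨le_rfl, le_top⟩
  have hmpos : ∀ i : ℕ, 0 < muOne a b (i + 1) := fun i =>
    muOne_pos ha hb (succ_mem_statesFromOne.2 (ENat.natCast_lt_top i))
  refine eq_zero_of_mul_sum_le (dualMu_nonneg ha hb) hp (ENNReal.ofReal_ne_top (r := a 1))
    fun n => ?_
  obtain ⟨g, q, hnq, hg1, hg0, hsum⟩ := exists_cutoff hmpos hm n
  have hfin : g.support.Finite := (Set.finite_Iio q).subset fun k hk => by
    by_contra h
    exact hk (hg0 k (not_lt.1 h))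
  have hmass : mass (statesFromZero ⊤) (muZero (dualDeath b) (dualBirth ⊤ a))
      (fun i => g i ^ 2) ≠ ⊤ := by
    rw [mass_dual_eq_tsum]
    refine Summable.tsum_ofReal_ne_top
      (summable_of_ne_finset_zero (s := range q) fun k hk => ?_)
    rw [hg0 k (by simpa using hk)]; ring
  calc _ ≤ lambdaND ⊤ (dualDeath b) (dualBirth ⊤ a) 0 *
        mass (statesFromZero ⊤) (muZero (dualDeath b) (dualBirth ⊤ a)) (fun i => g i ^ 2) := by
        gcongr
        exact sum_le_mass _ (fun i _ => show (i : ℕ∞) ≤ ⊤ from le_top)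
          fun i hi => hg1 i (mem_range.1 hi).le
    _ ≤ _ := lambdaND_mul_mass_le (fun i _ => show (i : ℕ∞) ≤ ⊤ from le_top) hfin hmass
    _ = ENNReal.ofReal (∑ i ∈ range q, a 1 * ((g (i + 1) - g i) ^ 2 / muOne a b (i + 1))) := by
        rw [energyN_dual ha hb]
        refine tsum_lt_eq_sum le_top (fun i _ => mul_nonneg ha1.le
          (div_nonneg (sq_nonneg _) (hmpos i).le)) fun i hi _ => ?_
        rw [hg0 i hi, hg0 (i + 1) (by omega)]; simp
    _ ≤ _ := by
        rw [← mul_sum]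
        exact ENNReal.ofReal_le_ofReal (mul_le_of_le_one_right ha1.le hsum)

/-- Here the roles are exchanged: `p` gives the resistances and μ the mass. The Dirichlet condition
at 0 forces one unit jump, of energy a₁ / p(0) = a₁, whence the bound 2a₁. -/
theorem lambdaDD_eq_zero (ha : ∀ i ∈ statesFromOne ⊤, 0 < a i)
    (hb : ∀ i ∈ statesFromOne ⊤, 0 < b i)
    (hp : ¬ Summable (muZero (dualDeath b) (dualBirth ⊤ a)))
    (hm : ¬ Summable fun i => muOne a b (i + 1)) : lambdaDD ⊤ a b = 0 := by
  have ha1 : 0 < a 1 := ha 1 ⟨le_rfl, le_top⟩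
  have hmpos : ∀ i : ℕ, 0 < muOne a b (i + 1) := fun i =>
    muOne_pos ha hb (succ_mem_statesFromOne.2 (ENat.natCast_lt_top i))
  refine eq_zero_of_mul_sum_le (fun i => (hmpos i).le) hm
    (ENNReal.ofReal_ne_top (r := a 1 * 2)) fun n => ?_
  -- Level `n + 1` ensures g(0) = g(1) = 1 and q ≥ 1 even for `n = 0`, so only the edge from 0 to 1
  -- changes when f(0) is reset to 0.
  obtain ⟨g, q, hnq, hg1, hg0, hsum⟩ := exists_cutoff
    (fun i => dualMu_pos ha hb i le_top) hp (n + 1)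
  set p := muZero (dualDeath b) (dualBirth ⊤ a) with hpdef
  set f : ℕ → ℝ := fun k => if k = 0 then 0 else g k with hf
  have hfg : ∀ k, f (k + 1) = g (k + 1) := fun k => if_neg (Nat.succ_ne_zero k)
  have hfq : ∀ k, q < k → f k = 0 := fun k hk => by
    simp only [hf, hg0 k hk.le, ite_self]
  have hfin : f.support.Finite := (Set.finite_Iic q).subset fun k hk => by
    by_contra h
    exact hk (hfq k (not_le.1 h))
  have hsupp : f.support ⊆ statesFromOne ⊤ := fun k hk =>
    ⟨Nat.one_le_iff_ne_zero.2 fun h => hk (if_pos h), le_top⟩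
  have hmass : mass (statesFromOne ⊤) (muOne a b) (fun i => f i ^ 2) ≠ ⊤ := by
    rw [mass_one_eq_sum ha hb (M := q) le_top hfq]
    exact ENNReal.ofReal_ne_top
  have henergy : ∑ i ∈ range (q + 1), (f (i + 1) - f i) ^ 2 / p i ≤ 2 := by
    obtain ⟨r, rfl⟩ : ∃ r, q = r + 1 := ⟨q - 1, by omega⟩
    rw [sum_range_succ', sum_range_succ]
    have hlast : f (r + 1 + 1) - f (r + 1) = 0 := by
      rw [hfg, hfg, hg0 _ le_rfl, hg0 _ (Nat.le_succ _), sub_self]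
    have hfirst : f (0 + 1) - f 0 = 1 := by
      rw [hfg, hg1 _ (by omega)]; simp [hf]
    have hp0 : p 0 = 1 := by simp [hpdef, muZero_zero]
    rw [sum_range_succ', hg1 _ (by omega), hg1 _ (by omega)] at hsum
    rw [hlast, hfirst, hp0]
    simp only [hfg]
    norm_num at hsum ⊢
    linarith
  calc _ = lambdaDD ⊤ a b * ∑ i ∈ (range n).image Nat.succ, ENNReal.ofReal (muOne a b i) := by
        rw [sum_image fun _ _ _ _ h => Nat.succ_injective h]
    _ ≤ lambdaDD ⊤ a b * mass (statesFromOne ⊤) (muOne a b) (fun i => f i ^ 2) := by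
        gcongr
        refine sum_le_mass _ (fun i hi => ?_) fun i hi => ?_
        · obtain ⟨j, -, rfl⟩ := mem_image.1 hi
          exact ⟨Nat.succ_pos j, le_top⟩
        · obtain ⟨j, hj, rfl⟩ := mem_image.1 hi
          have := mem_range.1 hj
          exact (hfg j).trans (hg1 _ (by omega))
    _ ≤ _ := lambdaDD_mul_mass_le hsupp hfin hmass
    _ ≤ _ := by
        rw [energyDD_eq_sum le_top ha hb (M := q) le_top hfq]
        exact ENNReal.ofReal_le_ofReal (mul_le_mul_of_nonneg_left henergy ha1.le)

/-- The reflecting problem has more test functions and a smaller energy. -/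
lemma lambdaDN_le_lambdaDD (N : ℕ∞) : lambdaDN N a b ≤ lambdaDD N a b := by
  refine le_sInf ?_
  rintro x ⟨f, hf, -, hmass, rfl⟩
  exact le_trans (b := energyDN N a b f) (sInf_le ⟨f, hf, hmass, rfl⟩) le_self_add

end Vanishing

end BirthDeath

theorem theorem7p1 (N : ℕ∞) (hN : 1 ≤ N) (a b : ℕ → ℝ)
    (ha : ∀ i ∈ BirthDeath.statesFromOne N, 0 < a i)
    (hb : ∀ i ∈ BirthDeath.statesFromOne N, 0 < b i) :
    ((∑' k : BirthDeath.statesFromOne N,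
          ENNReal.ofReal (1 / (BirthDeath.muOne a b k * a k))) < ⊤ →
      (∑' k : BirthDeath.statesFromZero N,
          ENNReal.ofReal (BirthDeath.muZero (BirthDeath.dualDeath b)
            (BirthDeath.dualBirth N a) k)) < ⊤ ∧
      BirthDeath.lambdaDD N a b =
        BirthDeath.spectralGap N (BirthDeath.dualDeath b) (BirthDeath.dualBirth N a)) ∧
    ((∑' k : BirthDeath.statesFromOne N,
          ENNReal.ofReal (1 / (BirthDeath.muOne a b k * a k))) = ⊤ →
      (∑' k : BirthDeath.statesFromOne N, ENNReal.ofReal (BirthDeath.muOne a b k)) = ⊤ →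
      BirthDeath.lambdaDD N a b = 0 ∧
      BirthDeath.lambdaDN N a b = 0 ∧
      BirthDeath.lambdaND N (BirthDeath.dualDeath b) (BirthDeath.dualBirth N a) 0 = 0) := by
  open BirthDeath in
  refine ⟨fun h => ?_, fun h1 h2 => ?_⟩
  · have hp := summable_dualMu hN ha hb h
    refine ⟨?_, le_antisymm (lambdaDD_le_spectralGap_dual hN ha hb)
      (spectralGap_dual_le_lambdaDD hN ha hb hp)⟩
    have := mass_dual_eq_tsum (N := N) (a := a) (b := b) fun _ => 1
    simp only [mass, mul_one] at this
    rw [this]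
    exact hp.tsum_ofReal_lt_top
  · obtain rfl := eq_top_of_tsum_statesFromOne_eq_top h2
    have hm := not_summable_of_tsum_statesFromOne_top h2
    have hp : ¬ Summable (muZero (dualDeath b) (dualBirth ⊤ a)) := by
      have h3 := not_summable_of_tsum_statesFromOne_top
        (F := fun k => 1 / (muOne a b k * a k)) h1
      refine fun hs => h3 ((hs.div_const (a 1)).congr fun i => ?_)
      rw [muOne_mul_death ha hb (ENat.natCast_lt_top i), one_div_div]
    have h0 := lambdaDD_eq_zero ha hb hp hm
    exact ⟨h0, le_antisymm (h0 ▸ lambdaDN_le_lambdaDD ⊤) bot_le,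
      lambdaND_dual_eq_zero ha hb hp hm⟩
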